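/- Let $n\ge 2$, let $\Omega\subset\mathbb{R}^n$ be the open unit ball centred at the origin, let $0<\alpha<\beta$ and $0<A<|\Omega|$. For a measurable set $D\subset\Omega$ let $\lambda(D)$ denote the smallest positive eigenvalue of $$-\operatorname{div}\big((\beta\chi_D+\alpha\chi_{D^c})\nabla u\big)=\lambda u\ \text{ in }\Omega,\qquad u=0\ \text{ on }\partial\Omega,$$ understood in the weak sense in $H^1_0(\Omega)$. Let $D_0\subset\Omega$ be measurable with $|D_0|=A$, let $u_0\in H^1_0(\Omega)$, $u_0\neq 0$, be an eigenfunction for the eigenvalue $\lambda(D_0)$, and put $$t=\inf\{s\in\mathbb{R}:\ |\{x\in\Omega:\ |\nabla u_0(x)|\le s\}|\ge A\},\qquad D_1=\{x\in\Omega:\ |\nabla u_0(x)|\le t\}.$$ Suppose that $|D_1|=A$. Then $\lambda(D_1)$ exists (the positive eigenvalues for $D_1$ have a least element) and $\lambda(D_1)\le\lambda(D_0)$. If moreover $D_1\neq D_0$ in the sense that $|D_1\,\triangle\,D_0|>0$, then $\lambda(D_1)<\lambda(D_0)$. -/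

import Mathlib

open MeasureTheory Set
open scoped ContDiff Gradient ENNReal

noncomputable section

namespace TwoPhase

/-- Test functions on `Ω`: smooth functions on `ℝⁿ` with compact support contained in `Ω`. -/
structure IsTestFunction {n : ℕ} (Ω : Set (EuclideanSpace ℝ (Fin n)))
    (φ : EuclideanSpace ℝ (Fin n) → ℝ) : Prop where
  smooth : ContDiff ℝ ∞ φ
  compact : HasCompactSupport φ
  support_subset : tsupport φ ⊆ Ω

/-- `g` is the weak gradient of `u` on `Ω`: `∫_Ω u ∇φ = - ∫_Ω φ g` for all test functions `φ`. -/
def HasWeakGradient {n : ℕ} (Ω : Set (EuclideanSpace ℝ (Fin n)))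
    (u : EuclideanSpace ℝ (Fin n) → ℝ)
    (g : EuclideanSpace ℝ (Fin n) → EuclideanSpace ℝ (Fin n)) : Prop :=
  ∀ φ : EuclideanSpace ℝ (Fin n) → ℝ, IsTestFunction Ω φ →
    ∫ x in Ω, u x • ∇ φ x = - ∫ x in Ω, φ x • g x

/-- `u ∈ H¹₀(Ω)` with weak gradient `g`: both are square integrable on `Ω`, `g` is the weak
gradient of `u`, and `u` is a limit of test functions in the norm of `H¹(Ω)`.
The pair `(u, g)` matters only up to almost everywhere equality on `Ω`. -/
structure MemH10 {n : ℕ} (Ω : Set (EuclideanSpace ℝ (Fin n)))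
    (u : EuclideanSpace ℝ (Fin n) → ℝ)
    (g : EuclideanSpace ℝ (Fin n) → EuclideanSpace ℝ (Fin n)) : Prop where
  memLp : MemLp u 2 (volume.restrict Ω)
  memLp_grad : MemLp g 2 (volume.restrict Ω)
  weakGradient : HasWeakGradient Ω u g
  approx : ∀ ε : ℝ≥0∞, 0 < ε → ∃ φ : EuclideanSpace ℝ (Fin n) → ℝ, IsTestFunction Ω φ ∧
    eLpNorm (fun x => u x - φ x) 2 (volume.restrict Ω) < ε ∧
    eLpNorm (fun x => g x - ∇ φ x) 2 (volume.restrict Ω) < ε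

open Classical in
/-- The conductivity `β χ_D + α χ_{Dᶜ}`. -/
def conductivity {n : ℕ} (α β : ℝ) (D : Set (EuclideanSpace ℝ (Fin n)))
    (x : EuclideanSpace ℝ (Fin n)) : ℝ :=
  if x ∈ D then β else α

/-- `u` (with weak gradient `g`) is an eigenfunction, for the eigenvalue `l`, of
`-div((β χ_D + α χ_{Dᶜ}) ∇u) = l u` in `Ω`, `u = 0` on `∂Ω`, in the weak sense. -/
structure IsEigenfunction {n : ℕ} (Ω : Set (EuclideanSpace ℝ (Fin n))) (α β : ℝ)
    (D : Set (EuclideanSpace ℝ (Fin n))) (l : ℝ)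
    (u : EuclideanSpace ℝ (Fin n) → ℝ)
    (g : EuclideanSpace ℝ (Fin n) → EuclideanSpace ℝ (Fin n)) : Prop where
  memH10 : MemH10 Ω u g
  ne_zero : ¬ (u =ᵐ[volume.restrict Ω] 0)
  weak_eq : ∀ φ : EuclideanSpace ℝ (Fin n) → ℝ, IsTestFunction Ω φ →
    ∫ x in Ω, conductivity α β D x * inner ℝ (g x) (∇ φ x) = l * ∫ x in Ω, u x * φ x

/-- The set of positive eigenvalues of the two-phase problem with region `D`. -/
def posEigenvalues {n : ℕ} (Ω : Set (EuclideanSpace ℝ (Fin n))) (α β : ℝ)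
    (D : Set (EuclideanSpace ℝ (Fin n))) : Set ℝ :=
  {l : ℝ | 0 < l ∧ ∃ u g, IsEigenfunction Ω α β D l u g}

/-- The ground state energy `λ(D)`: the smallest positive eigenvalue. -/
def groundStateEnergy {n : ℕ} (Ω : Set (EuclideanSpace ℝ (Fin n))) (α β : ℝ)
    (D : Set (EuclideanSpace ℝ (Fin n))) : ℝ :=
  sInf (posEigenvalues Ω α β D)

end TwoPhase

end

/-! The ground state energy `λ(D)` is the minimum over `H¹₀(Ω)` of the Rayleigh quotient `∫ σ_D
|∇u|² / ∫ u²`, where `σ_D` is the conductivity. For fixed `u` the numerator is `α ∫_Ω |∇u|² + (β -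
α) ∫_D |∇u|²`, so among sets of measure `A` it is smallest when `D` is a sublevel set of `|∇u|`.
With `u₀` as trial function for `D₁`, `λ(D₁) ∫ u₀² ≤ ∫ σ_{D₁} |∇u₀|² ≤ ∫ σ_{D₀} |∇u₀|² = λ(D₀) ∫
u₀²`, and the middle inequality is strict unless `D₁` and `D₀` agree up to a null set
(`setIntegral_sq_sublevel_le`).

The analytic work lies in the variational characterization, `exists_isLeast_posEigenvalues`. An
abstract minimization (`exists_rayleigh_minimizer`) needs a Poincaré inequality and Rellich
compactness. Both are proved on the Fourier side: frequencies beyond `R` are controlled by the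
gradient, and low frequencies by the finite volume of `Ω`. -/

namespace TwoPhase

/-! ### Minimizing a Rayleigh quotient in Hilbert space. -/

section Abstract

open Filter Topology

variable {V W : Type*} [NormedAddCommGroup V] [InnerProductSpace ℝ V]
  [NormedAddCommGroup W] [InnerProductSpace ℝ W]

/-- A nonnegative quadratic polynomial vanishing at the origin has no linear term. -/
lemma linear_coeff_eq_zero_of_nonneg {a b : ℝ} (h : ∀ s : ℝ, 0 ≤ 2 * s * a + s ^ 2 * b) :
    a = 0 := by
  -- The vertex `-a / b` may be undefined; with `|b| + 1` in place of `b` the value is still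
  -- negative unless `a = 0`.
  have h1 := h (-a / (|b| + 1))
  have hb : 0 < |b| + 1 := by positivity
  have h2 : 2 * (-a / (|b| + 1)) * a + (-a / (|b| + 1)) ^ 2 * b
      = a ^ 2 / (|b| + 1) ^ 2 * (b - 2 * (|b| + 1)) := by
    field_simp
    ring
  rw [h2] at h1
  by_contra ha
  have h3 : 0 < a ^ 2 / (|b| + 1) ^ 2 := by positivity
  have h4 : b - 2 * (|b| + 1) < 0 := by linarith [le_abs_self b, abs_nonneg b]
  linarith [mul_neg_of_pos_of_neg h3 h4]

/-- If `‖p.2‖² - m ‖p.1‖²` is nonnegative on a subspace and vanishes at `p`, then `p` satisfies the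
corresponding Euler equation. -/
lemma inner_eq_of_minimizer {S : Submodule ℝ (V × W)} {m : ℝ}
    (hm : ∀ q ∈ S, m * ‖q.1‖ ^ 2 ≤ ‖q.2‖ ^ 2) {p : V × W} (hp : p ∈ S)
    (hpm : ‖p.2‖ ^ 2 = m * ‖p.1‖ ^ 2) {q : V × W} (hq : q ∈ S) :
    inner ℝ p.2 q.2 = m * inner ℝ p.1 q.1 := by
  rw [← sub_eq_zero]
  refine linear_coeff_eq_zero_of_nonneg (b := ‖q.2‖ ^ 2 - m * ‖q.1‖ ^ 2) fun s => ?_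
  have h := hm (p + s • q) (S.add_mem hp (S.smul_mem s hq))
  rw [Prod.fst_add, Prod.snd_add, Prod.smul_fst, Prod.smul_snd, norm_add_sq_real,
    norm_add_sq_real, inner_smul_right, inner_smul_right, norm_smul, norm_smul, mul_pow, mul_pow,
    Real.norm_eq_abs, sq_abs] at h
  linear_combination h + hpm

lemma le_on_closure {S : Submodule ℝ (V × W)} {m : ℝ}
    (hm : ∀ q ∈ S, m * ‖q.1‖ ^ 2 ≤ ‖q.2‖ ^ 2) {q : V × W} (hq : q ∈ S.topologicalClosure) :
    m * ‖q.1‖ ^ 2 ≤ ‖q.2‖ ^ 2 := by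
  have hcl : IsClosed {q : V × W | m * ‖q.1‖ ^ 2 ≤ ‖q.2‖ ^ 2} :=
    isClosed_le (by fun_prop) (by fun_prop)
  have hq' : q ∈ closure (S : Set (V × W)) := by
    rwa [← Submodule.topologicalClosure_coe]
  exact closure_minimal (fun q hq => hm q hq) hcl hq'

/-- Existence of a minimizer of the Rayleigh quotient `‖p.2‖² / ‖p.1‖²` on the closure of a
subspace `S`, under a Poincaré inequality and a Rellich property on `S`. -/
theorem exists_rayleigh_minimizer [CompleteSpace V] [CompleteSpace W] (S : Submodule ℝ (V × W))
    {C : ℝ} (hP : ∀ p ∈ S, ‖p.1‖ ^ 2 ≤ C * ‖p.2‖ ^ 2)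
    (hK : ∀ p : ℕ → V × W, (∀ k, p k ∈ S) → ∀ R : ℝ, (∀ k, ‖(p k).2‖ ^ 2 ≤ R) →
      ∃ j : ℕ → ℕ, StrictMono j ∧ CauchySeq fun k => (p (j k)).1)
    (hne : ∃ p ∈ S, p.1 ≠ 0) :
    ∃ m > 0, (∀ q ∈ S.topologicalClosure, m * ‖q.1‖ ^ 2 ≤ ‖q.2‖ ^ 2) ∧
      ∃ p ∈ S.topologicalClosure, p.1 ≠ 0 ∧
        ∀ q ∈ S, inner ℝ p.2 q.2 = m * inner ℝ p.1 q.1 := by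
  set T : Set ℝ := {r | ∃ p ∈ S, ‖p.1‖ = 1 ∧ r = ‖p.2‖ ^ 2} with hT
  have hscale : ∀ p ∈ S, p.1 ≠ 0 → ‖p.2‖ ^ 2 / ‖p.1‖ ^ 2 ∈ T := by
    intro p hp h0
    have hn : ‖p.1‖ ≠ 0 := norm_ne_zero_iff.2 h0
    refine ⟨‖p.1‖⁻¹ • p, S.smul_mem _ hp, ?_, ?_⟩
    · rw [Prod.smul_fst, norm_smul, norm_inv, norm_norm, inv_mul_cancel₀ hn]
    · rw [Prod.smul_snd, norm_smul, norm_inv, norm_norm]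
      field_simp
  have hTne : T.Nonempty := let ⟨p, hp, h0⟩ := hne; ⟨_, hscale p hp h0⟩
  have hC : 0 < C := by
    obtain ⟨p, hp, h0⟩ := hne
    have h1 := hP p hp
    have h2 : 0 < ‖p.1‖ ^ 2 := by have := norm_pos_iff.2 h0; positivity
    by_contra! hC
    nlinarith [sq_nonneg ‖p.2‖]
  have hTlb : ∀ r ∈ T, C⁻¹ ≤ r := by
    rintro r ⟨p, hp, h1, rfl⟩
    have := hP p hp
    rw [h1] at this
    rw [inv_le_iff_one_le_mul₀ hC]
    linarith
  set m := sInf T with hm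
  have hmpos : 0 < m := (inv_pos.2 hC).trans_le (le_csInf hTne hTlb)
  have hmS : ∀ q ∈ S, m * ‖q.1‖ ^ 2 ≤ ‖q.2‖ ^ 2 := by
    intro q hq
    by_cases h0 : q.1 = 0
    · simp [h0]
    · have h2 : 0 < ‖q.1‖ ^ 2 := by have := norm_pos_iff.2 h0; positivity
      exact (le_div_iff₀ h2).1 (csInf_le ⟨_, hTlb⟩ (hscale q hq h0))
  have hmcl : ∀ q ∈ S.topologicalClosure, m * ‖q.1‖ ^ 2 ≤ ‖q.2‖ ^ 2 :=
    fun q hq => le_on_closure hmS hq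
  refine ⟨m, hmpos, hmcl, ?_⟩
  obtain ⟨a, -, ha, haT⟩ := exists_seq_tendsto_sInf hTne ⟨_, hTlb⟩
  choose p hpS hp1 hp2 using haT
  obtain ⟨R, hR⟩ := ha.bddAbove_range
  obtain ⟨j, hj, hcau⟩ := hK p hpS R fun k => (hp2 k) ▸ hR ⟨k, rfl⟩
  have haj : Tendsto (fun k => ‖(p (j k)).2‖ ^ 2) atTop (𝓝 m) := by
    simpa [← hp2, Function.comp_def] using ha.comp hj.tendsto_atTop
  -- The second components converge strongly, with no weak limits: their sums satisfy `‖g_k + g_l‖²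
  -- ≥ m ‖u_k + u_l‖²`, which is near `4m`, while `2 (‖g_k‖² + ‖g_l‖²)` also tends to `4m`. The
  -- parallelogram law makes the differences small; the errors add up to `3ε²/4`.
  have hcau2 : CauchySeq fun k => (p (j k)).2 := by
    rw [Metric.cauchySeq_iff]
    intro ε hε
    have hδ : 0 < ε ^ 2 / 8 := by positivity
    obtain ⟨N1, hN1⟩ := eventually_atTop.1
      (haj.eventually_lt_const (show m < m + ε ^ 2 / 8 by linarith))
    obtain ⟨N2, hN2⟩ := Metric.cauchySeq_iff.1 hcau (ε / (2 * √m)) (by positivity)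
    refine ⟨max N1 N2, fun k hk l hl => ?_⟩
    have hk1 := hN1 k (le_of_max_le_left hk)
    have hl1 := hN1 l (le_of_max_le_left hl)
    have hkl := hN2 k (le_of_max_le_right hk) l (le_of_max_le_right hl)
    rw [dist_eq_norm] at hkl ⊢
    have e1 := parallelogram_law_with_norm ℝ (p (j k)).1 (p (j l)).1
    have e2 := parallelogram_law_with_norm ℝ (p (j k)).2 (p (j l)).2
    have e3 := hmS _ (S.add_mem (hpS (j k)) (hpS (j l)))
    rw [Prod.fst_add, Prod.snd_add] at e3
    rw [hp1, hp1] at e1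
    have e4 : m * ‖(p (j k)).1 - (p (j l)).1‖ ^ 2 ≤ ε ^ 2 / 4 := by
      calc _ ≤ m * (ε / (2 * √m)) ^ 2 := by gcongr
        _ = ε ^ 2 / 4 := by
          rw [div_pow, mul_pow, Real.sq_sqrt hmpos.le]
          field_simp
          norm_num
    have e5 : m * ‖(p (j k)).1 + (p (j l)).1‖ ^ 2
        = m * 4 - m * ‖(p (j k)).1 - (p (j l)).1‖ ^ 2 := by
      linear_combination m * e1
    refine lt_of_pow_lt_pow_left₀ 2 hε.le ?_
    nlinarith
  obtain ⟨u, hu⟩ := cauchySeq_tendsto_of_complete hcau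
  obtain ⟨g, hg⟩ := cauchySeq_tendsto_of_complete hcau2
  have hmem : (u, g) ∈ S.topologicalClosure := by
    rw [← SetLike.mem_coe, Submodule.topologicalClosure_coe]
    exact mem_closure_of_tendsto (hu.prodMk_nhds hg)
      (Eventually.of_forall fun k => hpS (j k))
  have hu1 : ‖u‖ = 1 := tendsto_nhds_unique hu.norm (by simp [hp1])
  have hg1 : ‖g‖ ^ 2 = m := tendsto_nhds_unique (hg.norm.pow 2) haj
  refine ⟨(u, g), hmem, ?_, fun q hq => ?_⟩
  · rintro h
    simp only at h
    simp [h] at hu1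
  · exact inner_eq_of_minimizer hmcl hmem (by simp [hu1, hg1])
      (S.le_topologicalClosure hq)

end Abstract

/-! ### Test functions and the Poincaré inequality by frequency splitting. -/

section Fourier

open Filter Topology
open scoped FourierTransform SchwartzMap LineDeriv

variable {n : ℕ}

lemma integrable_schwartz_norm_sq (f : 𝓢(EuclideanSpace ℝ (Fin n), ℂ)) :
    Integrable fun x => ‖f x‖ ^ 2 :=
  (f.memLp 2 volume).integrable_norm_pow (by norm_num)

/-- In this normalization `∂ᵢ` becomes multiplication by `2πi ξᵢ`, so summing over `i` produces the
weight `(2π)² ‖ξ‖²`. -/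
lemma norm_fourier_lineDeriv_sq (f : 𝓢(EuclideanSpace ℝ (Fin n), ℂ)) (i : Fin n)
    (ξ : EuclideanSpace ℝ (Fin n)) :
    ‖𝓕 (∂_{EuclideanSpace.single i (1 : ℝ)} f :
      𝓢(EuclideanSpace ℝ (Fin n), ℂ)) ξ‖ ^ 2
      = (2 * Real.pi) ^ 2 * (ξ i) ^ 2 * ‖𝓕 f ξ‖ ^ 2 := by
  have : (inner ℝ · (EuclideanSpace.single i (1 : ℝ)) :
      EuclideanSpace ℝ (Fin n) → ℝ).HasTemperateGrowth := by fun_prop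
  rw [SchwartzMap.fourier_lineDerivOp_eq, smul_apply,
    SchwartzMap.smulLeftCLM_apply_apply this]
  simp [EuclideanSpace.inner_single_right, mul_pow, abs_of_pos Real.pi_pos]
  ring

/-- The `L²` mass of the Fourier transform at frequencies `≥ R` is controlled by the gradient. -/
lemma integral_norm_sq_le_low_freq_add (f : 𝓢(EuclideanSpace ℝ (Fin n), ℂ)) {R : ℝ}
    (hR : 0 < R) :
    ∫ x, ‖f x‖ ^ 2 ≤ (∫ ξ in Metric.ball 0 R, ‖𝓕 f ξ‖ ^ 2)
      + (R ^ 2)⁻¹ * ∫ x, ∑ i : Fin n, ‖(∂_{EuclideanSpace.single i (1 : ℝ)} f :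
      𝓢(EuclideanSpace ℝ (Fin n), ℂ)) x‖ ^ 2 := by
  have hsum : ∫ x, ∑ i : Fin n, ‖(∂_{EuclideanSpace.single i (1 : ℝ)} f :
      𝓢(EuclideanSpace ℝ (Fin n), ℂ)) x‖ ^ 2
      = ∫ ξ, ∑ i : Fin n, ‖𝓕 (∂_{EuclideanSpace.single i (1 : ℝ)} f :
      𝓢(EuclideanSpace ℝ (Fin n), ℂ)) ξ‖ ^ 2 := by
    rw [integral_finsetSum _ fun i _ => integrable_schwartz_norm_sq _,
      integral_finsetSum _ fun i _ => integrable_schwartz_norm_sq _]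
    exact Finset.sum_congr rfl fun i _ => (SchwartzMap.integral_norm_sq_fourier _).symm
  have hint : Integrable fun ξ => ∑ i : Fin n, ‖𝓕 (∂_{EuclideanSpace.single i (1 : ℝ)} f :
      𝓢(EuclideanSpace ℝ (Fin n), ℂ)) ξ‖ ^ 2 :=
    integrable_finsetSum _ fun i _ => integrable_schwartz_norm_sq _
  rw [← SchwartzMap.integral_norm_sq_fourier,
    ← integral_add_compl (Metric.isOpen_ball (x := 0) (ε := R)).measurableSet
      (integrable_schwartz_norm_sq (𝓕 f)), hsum]
  gcongr
  rw [← integral_const_mul]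
  refine (setIntegral_mono_on (integrable_schwartz_norm_sq (𝓕 f)).integrableOn
    (hint.const_mul _).integrableOn Metric.isOpen_ball.measurableSet.compl fun ξ hξ => ?_).trans
    (setIntegral_le_integral (hint.const_mul _)
      (Eventually.of_forall fun ξ => mul_nonneg (by positivity)
        (Finset.sum_nonneg fun i _ => by positivity)))
  simp_rw [norm_fourier_lineDeriv_sq, ← Finset.sum_mul, ← Finset.mul_sum]
  have h1 : ∑ i, ξ i ^ 2 = ‖ξ‖ ^ 2 := (EuclideanSpace.real_norm_sq_eq ξ).symm
  have h2 : R ^ 2 ≤ ‖ξ‖ ^ 2 := by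
    have : R ≤ ‖ξ‖ := by simpa using hξ
    gcongr
  -- The factor `(2π)²` is only bounded below by `1`, which leaves the simple constant `(R ^ 2)⁻¹`.
  have h3 : (1 : ℝ) ≤ (2 * Real.pi) ^ 2 := by nlinarith [Real.pi_gt_three]
  rw [h1, ← mul_assoc]
  refine le_mul_of_one_le_left (by positivity) ?_
  rw [← div_eq_inv_mul, le_div_iff₀ (by positivity), one_mul]
  nlinarith [sq_nonneg ‖ξ‖]

variable {Ω : Set (EuclideanSpace ℝ (Fin n))} {φ ψ : EuclideanSpace ℝ (Fin n) → ℝ}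

namespace IsTestFunction

/-- A test function as a complex valued Schwartz function. -/
noncomputable def toSchwartz (hφ : IsTestFunction Ω φ) : 𝓢(EuclideanSpace ℝ (Fin n), ℂ) :=
  HasCompactSupport.toSchwartzMap (f := fun x => (φ x : ℂ))
    (hφ.compact.comp_left (g := Complex.ofReal) Complex.ofReal_zero)
    (Complex.ofRealCLM.contDiff.comp hφ.smooth)

lemma toSchwartz_apply (hφ : IsTestFunction Ω φ) (x : EuclideanSpace ℝ (Fin n)) :
    hφ.toSchwartz x = φ x := rfl

lemma differentiable (hφ : IsTestFunction Ω φ) : Differentiable ℝ φ :=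
  hφ.smooth.differentiable (by simp)

lemma lineDeriv_toSchwartz (hφ : IsTestFunction Ω φ) (v x : EuclideanSpace ℝ (Fin n)) :
    (∂_{v} hφ.toSchwartz) x = ((inner ℝ (∇ φ x) v : ℝ) : ℂ) := by
  rw [SchwartzMap.lineDerivOp_apply_eq_fderiv, inner_gradient_left]
  have h : HasFDerivAt (fun x => (φ x : ℂ)) (Complex.ofRealCLM.comp (fderiv ℝ φ x)) x :=
    Complex.ofRealCLM.hasFDerivAt.comp x (hφ.differentiable x).hasFDerivAt
  change fderiv ℝ (fun x => (φ x : ℂ)) x v = _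
  rw [h.fderiv]
  rfl

lemma sum_lineDeriv_toSchwartz (hφ : IsTestFunction Ω φ) (x : EuclideanSpace ℝ (Fin n)) :
    ∑ i : Fin n, ‖(∂_{EuclideanSpace.single i (1 : ℝ)} hφ.toSchwartz :
      𝓢(EuclideanSpace ℝ (Fin n), ℂ)) x‖ ^ 2 = ‖∇ φ x‖ ^ 2 := by
  rw [EuclideanSpace.real_norm_sq_eq]
  refine Finset.sum_congr rfl fun i _ => ?_
  rw [hφ.lineDeriv_toSchwartz, EuclideanSpace.inner_single_right]
  simp

lemma integral_sq_le_low_freq_add (hφ : IsTestFunction Ω φ) {R : ℝ} (hR : 0 < R) :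
    ∫ x, φ x ^ 2 ≤ (∫ ξ in Metric.ball 0 R, ‖𝓕 (fun x => (φ x : ℂ)) ξ‖ ^ 2)
      + (R ^ 2)⁻¹ * ∫ x, ‖∇ φ x‖ ^ 2 := by
  have h := integral_norm_sq_le_low_freq_add hφ.toSchwartz hR
  simp_rw [hφ.sum_lineDeriv_toSchwartz, hφ.toSchwartz_apply] at h
  simp only [Complex.norm_real, Real.norm_eq_abs, sq_abs] at h
  exact h

lemma sub (hφ : IsTestFunction Ω φ) (hψ : IsTestFunction Ω ψ) :
    IsTestFunction Ω (fun x => φ x - ψ x) where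
  smooth := hφ.smooth.sub hψ.smooth
  compact := hφ.compact.sub hψ.compact
  support_subset := (tsupport_sub φ ψ).trans (union_subset hφ.support_subset hψ.support_subset)

lemma add (hφ : IsTestFunction Ω φ) (hψ : IsTestFunction Ω ψ) :
    IsTestFunction Ω (fun x => φ x + ψ x) where
  smooth := hφ.smooth.add hψ.smooth
  compact := hφ.compact.add hψ.compact
  support_subset := (tsupport_add φ ψ).trans (union_subset hφ.support_subset hψ.support_subset)

lemma const_mul (hφ : IsTestFunction Ω φ) (c : ℝ) : IsTestFunction Ω (fun x => c * φ x) where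
  smooth := contDiff_const.mul hφ.smooth
  compact := hφ.compact.mul_left
  support_subset := (closure_mono fun x hx => by
    simp only [Function.mem_support] at hx ⊢
    exact right_ne_zero_of_mul hx).trans hφ.support_subset

lemma zero : IsTestFunction Ω (fun _ => (0 : ℝ)) where
  smooth := contDiff_const
  compact := HasCompactSupport.zero
  support_subset := by simp [tsupport, Function.support]

lemma eq_zero_of_notMem (hφ : IsTestFunction Ω φ) {x : EuclideanSpace ℝ (Fin n)} (hx : x ∉ Ω) :
    φ x = 0 :=
  image_eq_zero_of_notMem_tsupport fun h => hx (hφ.support_subset h)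

lemma continuous_gradient (hφ : IsTestFunction Ω φ) : Continuous (∇ φ) :=
  (InnerProductSpace.toDual ℝ _).symm.continuous.comp (hφ.smooth.continuous_fderiv (by simp))

lemma gradient_eq_zero_of_notMem_tsupport {x : EuclideanSpace ℝ (Fin n)} (hx : x ∉ tsupport φ) :
    ∇ φ x = 0 := by
  have h : fderiv ℝ φ x = 0 := by
    by_contra h
    exact hx (support_fderiv_subset ℝ h)
  simp [gradient, h]

lemma gradient_eq_zero_of_notMem (hφ : IsTestFunction Ω φ) {x : EuclideanSpace ℝ (Fin n)}
    (hx : x ∉ Ω) : ∇ φ x = 0 :=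
  gradient_eq_zero_of_notMem_tsupport fun h => hx (hφ.support_subset h)

lemma hasCompactSupport_gradient (hφ : IsTestFunction Ω φ) : HasCompactSupport (∇ φ) :=
  HasCompactSupport.intro hφ.compact fun _ hx => gradient_eq_zero_of_notMem_tsupport hx

lemma memLp (hφ : IsTestFunction Ω φ) : MemLp φ 2 (volume.restrict Ω) :=
  (hφ.smooth.continuous.memLp_of_hasCompactSupport hφ.compact).restrict _

lemma memLp_gradient (hφ : IsTestFunction Ω φ) : MemLp (∇ φ) 2 (volume.restrict Ω) :=
  (hφ.continuous_gradient.memLp_of_hasCompactSupport hφ.hasCompactSupport_gradient).restrict _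

lemma setIntegral_sq (hφ : IsTestFunction Ω φ) : ∫ x in Ω, φ x ^ 2 = ∫ x, φ x ^ 2 :=
  setIntegral_eq_integral_of_forall_compl_eq_zero fun x hx => by
    simp [hφ.eq_zero_of_notMem hx]

lemma setIntegral_norm_gradient_sq (hφ : IsTestFunction Ω φ) :
    ∫ x in Ω, ‖∇ φ x‖ ^ 2 = ∫ x, ‖∇ φ x‖ ^ 2 :=
  setIntegral_eq_integral_of_forall_compl_eq_zero fun x hx => by
    simp [hφ.gradient_eq_zero_of_notMem hx]

/-- The transform is bounded by the `L¹` norm, and Cauchy–Schwarz on the finite-volume set `Ω`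
passes to `L²`. Being uniform in `ξ`, the bound controls the low frequencies. -/
lemma norm_fourier_sq_le (hφ : IsTestFunction Ω φ) (hΩ : volume Ω ≠ ⊤)
    (ξ : EuclideanSpace ℝ (Fin n)) :
    ‖𝓕 (fun x => (φ x : ℂ)) ξ‖ ^ 2 ≤ volume.real Ω * ∫ x in Ω, φ x ^ 2 := by
  have : IsFiniteMeasure (volume.restrict Ω) := ⟨by simpa using hΩ.lt_top⟩
  have h1 : ‖𝓕 (fun x => (φ x : ℂ)) ξ‖ ≤ ∫ x in Ω, ‖φ x‖ := by
    rw [Real.fourier_eq]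
    refine (norm_integral_le_integral_norm _).trans_eq ?_
    rw [setIntegral_eq_integral_of_forall_compl_eq_zero fun x hx => by
      simp [hφ.eq_zero_of_notMem hx]]
    simp [Circle.norm_smul]
  have h2 : (∫ x in Ω, ‖φ x‖) ^ 2 ≤ volume.real Ω * ∫ x in Ω, φ x ^ 2 := by
    have h := integral_mul_norm_le_Lp_mul_Lq (μ := volume.restrict Ω) (p := 2) (q := 2)
      (f := fun _ => (1 : ℝ)) (g := φ) (by constructor <;> norm_num)
      (memLp_const _) (by simpa using hφ.memLp)
    have hi : 0 ≤ ∫ x in Ω, φ x ^ 2 := integral_nonneg fun x => sq_nonneg _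
    have h' : ∫ x in Ω, ‖φ x‖ ≤ √(volume.real Ω) * √(∫ x in Ω, φ x ^ 2) := by
      simpa [Real.sqrt_eq_rpow] using h
    calc _ ≤ (√(volume.real Ω) * √(∫ x in Ω, φ x ^ 2)) ^ 2 := by
          gcongr
      _ = _ := by rw [mul_pow, Real.sq_sqrt measureReal_nonneg, Real.sq_sqrt hi]
  exact (by gcongr : _ ≤ _).trans h2

/-- The Poincaré inequality for test functions. -/
theorem poincare (hn : 0 < n) (hΩ : volume Ω ≠ ⊤) :
    ∃ C > 0, ∀ φ : EuclideanSpace ℝ (Fin n) → ℝ, IsTestFunction Ω φ →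
      ∫ x in Ω, φ x ^ 2 ≤ C * ∫ x in Ω, ‖∇ φ x‖ ^ 2 := by
  -- The low frequencies contribute at most `|B_R| |Ω| ∫ φ²`; with `|B_R| |Ω| ≤ 1/2` this is
  -- absorbed into the left-hand side.
  obtain ⟨R, hR, hR2⟩ : ∃ R > 0, volume.real (Metric.ball (0 : EuclideanSpace ℝ (Fin n)) R) *
      volume.real Ω ≤ 1 / 2 := by
    have : Nonempty (Fin n) := ⟨⟨0, hn⟩⟩
    set b := volume.real (Metric.ball (0 : EuclideanSpace ℝ (Fin n)) 1) with hb
    have hb0 : 0 ≤ b := measureReal_nonneg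
    have hv : 0 ≤ volume.real Ω := measureReal_nonneg
    refine ⟨(2 * b * volume.real Ω + 1)⁻¹, by positivity, ?_⟩
    set r := (2 * b * volume.real Ω + 1)⁻¹ with hr
    have hr0 : 0 < r := by positivity
    have hr1 : r ≤ 1 := inv_le_one_of_one_le₀ (by nlinarith [mul_nonneg hb0 hv])
    have h1 : volume.real (Metric.ball (0 : EuclideanSpace ℝ (Fin n)) r) = r ^ n * b := by
      rw [hb, measureReal_def, measureReal_def, Measure.addHaar_ball _ _ hr0.le]
      simp [hr0.le]
    -- As `r ≤ 1` and `n ≥ 1`, the volume of the ball is at most linear in `r`, which explains the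
    -- choice of `r`.
    have h2 : r ^ n ≤ r := by
      simpa using pow_le_pow_of_le_one hr0.le hr1 hn
    have h3 : r * (2 * b * volume.real Ω + 1) = 1 := inv_mul_cancel₀ (by positivity)
    rw [h1]
    have : r ^ n * b * volume.real Ω ≤ r * b * volume.real Ω := by gcongr
    nlinarith
  refine ⟨2 * (R ^ 2)⁻¹, by positivity, fun φ hφ => ?_⟩
  have h := hφ.integral_sq_le_low_freq_add hR
  rw [← hφ.setIntegral_sq, ← hφ.setIntegral_norm_gradient_sq] at h
  have h4 : ∫ ξ in Metric.ball (0 : EuclideanSpace ℝ (Fin n)) R, ‖𝓕 (fun x => (φ x : ℂ)) ξ‖ ^ 2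
      ≤ volume.real (Metric.ball (0 : EuclideanSpace ℝ (Fin n)) R) *
        (volume.real Ω * ∫ x in Ω, φ x ^ 2) := by
    have := setIntegral_mono_on (μ := volume)
      (s := Metric.ball (0 : EuclideanSpace ℝ (Fin n)) R)
      (integrable_schwartz_norm_sq (𝓕 hφ.toSchwartz)).integrableOn
      (integrableOn_const (C := volume.real Ω * ∫ x in Ω, φ x ^ 2) measure_ball_lt_top.ne)
      Metric.isOpen_ball.measurableSet fun ξ _ => hφ.norm_fourier_sq_le hΩ ξ
    rw [setIntegral_const, smul_eq_mul] at this
    exact this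
  have hi : 0 ≤ ∫ x in Ω, φ x ^ 2 := integral_nonneg fun x => sq_nonneg _
  nlinarith [mul_le_mul_of_nonneg_right hR2 hi]

end IsTestFunction

end Fourier

/-! ### Rellich compactness. -/

section Rellich

open Filter Topology
open scoped FourierTransform SchwartzMap LineDeriv

variable {n : ℕ} {Ω : Set (EuclideanSpace ℝ (Fin n))} {φ ψ : EuclideanSpace ℝ (Fin n) → ℝ}

lemma gradient_add_apply (hφ : Differentiable ℝ φ) (hψ : Differentiable ℝ ψ)
    (x : EuclideanSpace ℝ (Fin n)) : ∇ (fun x => φ x + ψ x) x = ∇ φ x + ∇ ψ x := by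
  simp only [gradient]
  rw [fderiv_fun_add (hφ x) (hψ x), map_add]

lemma gradient_sub_apply (hφ : Differentiable ℝ φ) (hψ : Differentiable ℝ ψ)
    (x : EuclideanSpace ℝ (Fin n)) : ∇ (fun x => φ x - ψ x) x = ∇ φ x - ∇ ψ x := by
  simp only [gradient]
  rw [fderiv_fun_sub (hφ x) (hψ x), map_sub]

lemma gradient_const_mul_apply (hφ : Differentiable ℝ φ) (c : ℝ)
    (x : EuclideanSpace ℝ (Fin n)) : ∇ (fun x => c * φ x) x = c • ∇ φ x := by
  simp only [gradient]
  rw [fderiv_const_mul (hφ x), map_smulₛₗ]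
  simp

namespace IsTestFunction

lemma continuous_fourier (hφ : IsTestFunction Ω φ) : Continuous (𝓕 (fun x => (φ x : ℂ))) :=
  (𝓕 hφ.toSchwartz).continuous

lemma fourier_sub (hφ : IsTestFunction Ω φ) (hψ : IsTestFunction Ω ψ)
    (ξ : EuclideanSpace ℝ (Fin n)) :
    𝓕 (fun x => ((φ x - ψ x : ℝ) : ℂ)) ξ
      = 𝓕 (fun x => (φ x : ℂ)) ξ - 𝓕 (fun x => (ψ x : ℂ)) ξ := by
  have h1 : (hφ.sub hψ).toSchwartz = hφ.toSchwartz - hψ.toSchwartz := by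
    ext x
    simp [toSchwartz_apply]
  have h2 : 𝓕 (hφ.toSchwartz - hψ.toSchwartz) = 𝓕 hφ.toSchwartz - 𝓕 hψ.toSchwartz :=
    map_sub (SchwartzMap.fourierTransformCLM ℂ) _ _
  change 𝓕 (hφ.sub hψ).toSchwartz ξ = 𝓕 hφ.toSchwartz ξ - 𝓕 hψ.toSchwartz ξ
  rw [h1, h2]
  rfl

lemma setIntegral_norm_gradient_sub_sq_le (hφ : IsTestFunction Ω φ) (hψ : IsTestFunction Ω ψ) :
    ∫ x in Ω, ‖∇ (fun x => φ x - ψ x) x‖ ^ 2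
      ≤ 2 * ((∫ x in Ω, ‖∇ φ x‖ ^ 2) + ∫ x in Ω, ‖∇ ψ x‖ ^ 2) := by
  have i1 := hφ.memLp_gradient.integrable_norm_pow (by norm_num)
  have i2 := hψ.memLp_gradient.integrable_norm_pow (by norm_num)
  rw [← integral_add i1 i2, ← integral_const_mul]
  refine integral_mono ((hφ.sub hψ).memLp_gradient.integrable_norm_pow (by norm_num))
    ((i1.add i2).const_mul _) fun x => ?_
  have h := parallelogram_law_with_norm ℝ (∇ φ x) (∇ ψ x)
  simp only [gradient_sub_apply hφ.differentiable hψ.differentiable]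
  nlinarith [sq_nonneg ‖∇ φ x + ∇ ψ x‖]

/-- A sequence of test functions bounded in `L²` has a subsequence whose Fourier transforms
converge pointwise. -/
theorem exists_subseq_tendsto_fourier (hΩ : volume Ω ≠ ⊤)
    {φ : ℕ → EuclideanSpace ℝ (Fin n) → ℝ} (hφ : ∀ k, IsTestFunction Ω (φ k)) {M : ℝ}
    (hM : ∀ k, ∫ x in Ω, φ k x ^ 2 ≤ M) :
    ∃ j : ℕ → ℕ, StrictMono j ∧ ∃ c : EuclideanSpace ℝ (Fin n) → ℂ, ∀ ξ,
      Tendsto (fun k => 𝓕 (fun x => (φ (j k) x : ℂ)) ξ) atTop (𝓝 (c ξ)) := by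
  have : IsFiniteMeasure (volume.restrict Ω) := ⟨by simpa using hΩ.lt_top⟩
  -- Provides separability of `L²`, on which sequential weak-* compactness of balls rests.
  have : Fact ((2 : ℝ≥0∞) ≠ ⊤) := ⟨by norm_num⟩
  have hmem : ∀ k, MemLp (fun x => (φ k x : ℂ)) 2 (volume.restrict Ω) := fun k =>
    (hφ k).memLp.ofReal
  let F : ℕ → Lp ℂ 2 (volume.restrict Ω) := fun k => (hmem k).toLp
  have hF : ∀ k, ‖F k‖ ≤ √M := fun k => by
    refine Real.le_sqrt_of_sq_le ?_
    refine le_trans (le_of_eq ?_) (hM k)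
    have h : ((‖F k‖ ^ 2 : ℝ) : ℂ) = ((∫ x in Ω, φ k x ^ 2 : ℝ) : ℂ) := by
      rw [← integral_complex_ofReal]
      have h0 := inner_self_eq_norm_sq_to_K (𝕜 := ℂ) (F k)
      rw [L2.inner_def] at h0
      push_cast
      refine h0.symm.trans (integral_congr_ae ?_)
      filter_upwards [(hmem k).coeFn_toLp] with x hx
      simp only [F, hx]
      simp [sq, ← Complex.ofReal_mul]
    exact_mod_cast h
  let G : ℕ → WeakDual ℂ (Lp ℂ 2 (volume.restrict Ω)) := fun k =>
    StrongDual.toWeakDual (innerSL ℂ (F k))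
  obtain ⟨g, -, j, hj, hg⟩ := WeakDual.isSeqCompact_closedBall ℂ
    (Lp ℂ 2 (volume.restrict Ω)) 0 (√M) (x := G) fun k => by
      simpa [G] using hF k
  refine ⟨j, hj, ?_⟩
  -- On a set of finite measure the characters are in `L²`, so weak convergence can be tested on
  -- them; this gives pointwise convergence of the Fourier transforms.
  have hexp : ∀ ξ : EuclideanSpace ℝ (Fin n), MemLp
      (fun x => ((Real.fourierChar (-(inner ℝ x ξ)) : Circle) : ℂ)) 2 (volume.restrict Ω) :=
    fun ξ => MemLp.of_bound (Continuous.aestronglyMeasurable (by fun_prop)) 1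
      (Eventually.of_forall fun x => (Circle.norm_coe _).le)
  refine ⟨fun ξ => g (hexp ξ).toLp, fun ξ => ?_⟩
  have h := ((WeakDual.eval_continuous ((hexp ξ).toLp)).tendsto g).comp hg
  refine h.congr fun k => ?_
  -- The inner product conjugates its first argument, harmlessly since `φ (j k)` is real valued.
  change inner ℂ (F (j k)) ((hexp ξ).toLp) = _
  have hΩint : 𝓕 (fun x => (φ (j k) x : ℂ)) ξ
      = ∫ x in Ω, Real.fourierChar (-(inner ℝ x ξ)) • (φ (j k) x : ℂ) := by
    rw [Real.fourier_eq, setIntegral_eq_integral_of_forall_compl_eq_zero]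
    intro x hx
    simp [(hφ (j k)).eq_zero_of_notMem hx]
  rw [L2.inner_def, hΩint]
  refine integral_congr_ae ?_
  filter_upwards [(hmem (j k)).coeFn_toLp, (hexp ξ).coeFn_toLp] with x hx hx'
  simp only [F, hx, hx']
  simp [Circle.smul_def]

/-- **Rellich's theorem** for test functions: a sequence bounded in `H¹` has a subsequence that is
Cauchy in `L²`. -/
theorem rellich (hΩ : volume Ω ≠ ⊤)
    {φ : ℕ → EuclideanSpace ℝ (Fin n) → ℝ} (hφ : ∀ k, IsTestFunction Ω (φ k)) {M R : ℝ}
    (hM : ∀ k, ∫ x in Ω, φ k x ^ 2 ≤ M) (hR : ∀ k, ∫ x in Ω, ‖∇ (φ k) x‖ ^ 2 ≤ R) :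
    ∃ j : ℕ → ℕ, StrictMono j ∧ ∀ ε > 0, ∃ N, ∀ k ≥ N, ∀ l ≥ N,
      ∫ x in Ω, (φ (j k) x - φ (j l) x) ^ 2 < ε := by
  obtain ⟨j, hj, c, hc⟩ := exists_subseq_tendsto_fourier hΩ hφ hM
  refine ⟨j, hj, fun ε hε => ?_⟩
  have hR0 : 0 ≤ R := (integral_nonneg fun x => by positivity).trans (hR 0)
  -- Differences have squared gradient norm at most `4R`, so frequencies beyond `r` cost less than
  -- `ε / 2`. The `+ 1` in the witness keeps `r` positive when `R = 0`.
  obtain ⟨r, hr, hr2⟩ : ∃ r > 0, (r ^ 2)⁻¹ * (4 * R) < ε / 2 := by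
    refine ⟨√(8 * R / ε + 1), by positivity, ?_⟩
    rw [Real.sq_sqrt (by positivity), inv_mul_lt_iff₀ (by positivity)]
    field_simp
    nlinarith
  set B := Metric.ball (0 : EuclideanSpace ℝ (Fin n)) r with hB
  have hBfin : IsFiniteMeasure (volume.restrict B) :=
    ⟨by simpa using measure_ball_lt_top⟩
  set K : ℝ := volume.real Ω * M with hK
  have hb : ∀ k ξ, ‖𝓕 (fun x => (φ (j k) x : ℂ)) ξ‖ ^ 2 ≤ K := fun k ξ =>
    ((hφ (j k)).norm_fourier_sq_le hΩ ξ).trans (by rw [hK]; gcongr; exact hM _)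
  have hcb : ∀ ξ, ‖c ξ‖ ^ 2 ≤ K := fun ξ =>
    le_of_tendsto ((hc ξ).norm.pow 2) (Eventually.of_forall fun k => hb k ξ)
  have htri : ∀ a b : ℂ, ‖a - b‖ ^ 2 ≤ 2 * ‖a‖ ^ 2 + 2 * ‖b‖ ^ 2 := fun a b => by
    nlinarith [parallelogram_law_with_norm ℝ a b, sq_nonneg ‖a + b‖]
  have hcm : AEStronglyMeasurable c (volume.restrict B) :=
    aestronglyMeasurable_of_tendsto_ae atTop
      (fun k => (hφ (j k)).continuous_fourier.aestronglyMeasurable)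
      (Eventually.of_forall fun ξ => hc ξ)
  have hmeas : ∀ k, AEStronglyMeasurable
      (fun ξ => ‖𝓕 (fun x => (φ (j k) x : ℂ)) ξ - c ξ‖ ^ 2) (volume.restrict B) := fun k =>
    (((hφ (j k)).continuous_fourier.aestronglyMeasurable.sub hcm).norm).pow 2
  have hbd : ∀ k ξ, ‖‖𝓕 (fun x => (φ (j k) x : ℂ)) ξ - c ξ‖ ^ 2‖ ≤ 4 * K := fun k ξ => by
    rw [Real.norm_of_nonneg (by positivity)]
    linarith [htri (𝓕 (fun x => (φ (j k) x : ℂ)) ξ) (c ξ), hb k ξ, hcb ξ]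
  have hint : ∀ k, Integrable
      (fun ξ => ‖𝓕 (fun x => (φ (j k) x : ℂ)) ξ - c ξ‖ ^ 2) (volume.restrict B) := fun k =>
    Integrable.of_bound (hmeas k) (4 * K) (Eventually.of_forall fun ξ => hbd k ξ)
  -- On the ball the transforms are uniformly bounded, so pointwise convergence upgrades to `L²`
  -- convergence. Comparing with the limit `c` reduces the Cauchy property to a single index.
  have hlim : Tendsto (fun k => ∫ ξ in B, ‖𝓕 (fun x => (φ (j k) x : ℂ)) ξ - c ξ‖ ^ 2) atTop
      (𝓝 0) := by
    have := tendsto_integral_of_dominated_convergence (μ := volume.restrict B)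
      (F := fun k ξ => ‖𝓕 (fun x => (φ (j k) x : ℂ)) ξ - c ξ‖ ^ 2) (f := fun _ => (0 : ℝ))
      (fun _ => 4 * K) hmeas (integrable_const _)
      (fun k => Eventually.of_forall fun ξ => hbd k ξ)
      (Eventually.of_forall fun ξ => by
        have h := ((hc ξ).sub_const (c ξ)).norm.pow 2
        simpa using h)
    simpa using this
  obtain ⟨N, hN⟩ := eventually_atTop.1 (hlim.eventually_lt_const (show 0 < ε / 8 by positivity))
  refine ⟨N, fun k hk l hl => ?_⟩
  have h1 := ((hφ (j k)).sub (hφ (j l))).integral_sq_le_low_freq_add hr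
  rw [← ((hφ (j k)).sub (hφ (j l))).setIntegral_sq,
    ← ((hφ (j k)).sub (hφ (j l))).setIntegral_norm_gradient_sq] at h1
  simp_rw [(hφ (j k)).fourier_sub (hφ (j l))] at h1
  have h2 := (hφ (j k)).setIntegral_norm_gradient_sub_sq_le (hφ (j l))
  have h3 : (r ^ 2)⁻¹ * ∫ x in Ω, ‖∇ (fun x => φ (j k) x - φ (j l) x) x‖ ^ 2 < ε / 2 := by
    refine lt_of_le_of_lt ?_ hr2
    gcongr
    linarith [hR (j k), hR (j l)]
  have h4 : ∫ ξ in B, ‖𝓕 (fun x => (φ (j k) x : ℂ)) ξ - 𝓕 (fun x => (φ (j l) x : ℂ)) ξ‖ ^ 2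
      ≤ 2 * (∫ ξ in B, ‖𝓕 (fun x => (φ (j k) x : ℂ)) ξ - c ξ‖ ^ 2)
        + 2 * ∫ ξ in B, ‖𝓕 (fun x => (φ (j l) x : ℂ)) ξ - c ξ‖ ^ 2 := by
    rw [← integral_const_mul, ← integral_const_mul,
      ← integral_add ((hint k).const_mul 2) ((hint l).const_mul 2)]
    refine integral_mono_of_nonneg (Eventually.of_forall fun ξ => by positivity)
      (((hint k).const_mul 2).add ((hint l).const_mul 2)) (Eventually.of_forall fun ξ => ?_)
    have := htri (𝓕 (fun x => (φ (j k) x : ℂ)) ξ - c ξ) (𝓕 (fun x => (φ (j l) x : ℂ)) ξ - c ξ)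
    rwa [sub_sub_sub_cancel_right] at this
  linarith [hN k hk, hN l hl]

end IsTestFunction

end Rellich

/-! ### The energy space with weight `√σ`, and its identification with `H¹₀(Ω)`. -/

section Energy

open Filter Topology

variable {n : ℕ} {Ω D : Set (EuclideanSpace ℝ (Fin n))} {α β : ℝ}

lemma le_conductivity (hαβ : α ≤ β) (x : EuclideanSpace ℝ (Fin n)) :
    α ≤ conductivity α β D x := by
  unfold conductivity
  split_ifs <;> linarith

lemma conductivity_le (hαβ : α ≤ β) (x : EuclideanSpace ℝ (Fin n)) :
    conductivity α β D x ≤ β := by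
  unfold conductivity
  split_ifs <;> linarith

lemma aestronglyMeasurable_conductivity {μ : Measure (EuclideanSpace ℝ (Fin n))}
    (hD : NullMeasurableSet D μ) : AEStronglyMeasurable (conductivity α β D) μ := by
  classical
  have h : conductivity α β D = fun x => α + D.indicator (fun _ => β - α) x := by
    funext x
    by_cases hx : x ∈ D <;> simp [conductivity, hx]
  rw [h]
  exact aestronglyMeasurable_const.add (aestronglyMeasurable_const.indicator₀ hD)

lemma aestronglyMeasurable_sqrt_conductivity {μ : Measure (EuclideanSpace ℝ (Fin n))}
    (hD : NullMeasurableSet D μ) : AEStronglyMeasurable (fun x => √(conductivity α β D x)) μ :=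
  Real.continuous_sqrt.comp_aestronglyMeasurable (aestronglyMeasurable_conductivity hD)

section Weight

variable {g h : EuclideanSpace ℝ (Fin n) → EuclideanSpace ℝ (Fin n)}

lemma norm_sqrt_conductivity_smul_le (hαβ : α ≤ β) (x v : EuclideanSpace ℝ (Fin n)) :
    ‖√(conductivity α β D x) • v‖ ≤ √β * ‖v‖ := by
  rw [norm_smul, Real.norm_of_nonneg (Real.sqrt_nonneg _)]
  gcongr
  exact conductivity_le hαβ x

lemma norm_le_inv_sqrt_mul (hα : 0 < α) (hαβ : α ≤ β) (x v : EuclideanSpace ℝ (Fin n)) :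
    ‖v‖ ≤ (√α)⁻¹ * ‖√(conductivity α β D x) • v‖ := by
  rw [norm_smul, Real.norm_of_nonneg (Real.sqrt_nonneg _), ← mul_assoc]
  refine le_mul_of_one_le_left (norm_nonneg v) ?_
  rw [← div_eq_inv_mul, le_div_iff₀ (by positivity), one_mul]
  exact Real.sqrt_le_sqrt (le_conductivity hαβ x)

lemma sqrt_conductivity_ne_zero (hα : 0 < α) (hαβ : α ≤ β) (x : EuclideanSpace ℝ (Fin n)) :
    √(conductivity α β D x) ≠ 0 :=
  (Real.sqrt_pos.2 (hα.trans_le (le_conductivity hαβ x))).ne'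

lemma memLp_sqrt_conductivity_smul (hαβ : α ≤ β)
    (hD : NullMeasurableSet D (volume.restrict Ω)) (hg : MemLp g 2 (volume.restrict Ω)) :
    MemLp (fun x => √(conductivity α β D x) • g x) 2 (volume.restrict Ω) :=
  hg.of_le_mul ((aestronglyMeasurable_sqrt_conductivity hD).smul hg.1)
    (Eventually.of_forall fun x => norm_sqrt_conductivity_smul_le hαβ x (g x))

lemma memLp_inv_sqrt_conductivity_smul (hα : 0 < α) (hαβ : α ≤ β)
    (hD : NullMeasurableSet D (volume.restrict Ω)) (hg : MemLp g 2 (volume.restrict Ω)) :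
    MemLp (fun x => (√(conductivity α β D x))⁻¹ • g x) 2 (volume.restrict Ω) :=
  hg.of_le_mul (((aestronglyMeasurable_sqrt_conductivity hD).aemeasurable.inv.aestronglyMeasurable).smul
    hg.1) (Eventually.of_forall fun x => by
      simpa [smul_inv_smul₀ (sqrt_conductivity_ne_zero hα hαβ x)] using
        norm_le_inv_sqrt_mul (D := D) hα hαβ x ((√(conductivity α β D x))⁻¹ • g x))

lemma inner_toLp_eq_integral_mul {f₁ f₂ : Lp ℝ 2 (volume.restrict Ω)}
    {u v : EuclideanSpace ℝ (Fin n) → ℝ} (hu : f₁ =ᵐ[volume.restrict Ω] u)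
    (hv : f₂ =ᵐ[volume.restrict Ω] v) : inner ℝ f₁ f₂ = ∫ x in Ω, u x * v x := by
  rw [L2.inner_def]
  refine integral_congr_ae ?_
  filter_upwards [hu, hv] with x h1 h2
  simp [h1, h2, mul_comm]

lemma norm_sq_eq_integral_sq {f : Lp ℝ 2 (volume.restrict Ω)}
    {u : EuclideanSpace ℝ (Fin n) → ℝ} (hu : f =ᵐ[volume.restrict Ω] u) :
    ‖f‖ ^ 2 = ∫ x in Ω, u x ^ 2 := by
  rw [← real_inner_self_eq_norm_sq, inner_toLp_eq_integral_mul hu hu]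
  simp_rw [sq]

/-- Storing `√σ ∇u` instead of `∇u` turns the energy form into the plain `L²` inner product, the
form required by `exists_rayleigh_minimizer`. -/
lemma inner_toLp_eq_energy (hα : 0 < α) (hαβ : α ≤ β)
    {f₁ f₂ : Lp (EuclideanSpace ℝ (Fin n)) 2 (volume.restrict Ω)}
    (hg : f₁ =ᵐ[volume.restrict Ω] fun x => √(conductivity α β D x) • g x)
    (hh : f₂ =ᵐ[volume.restrict Ω] fun x => √(conductivity α β D x) • h x) :
    inner ℝ f₁ f₂ = ∫ x in Ω, conductivity α β D x * inner ℝ (g x) (h x) := by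
  rw [L2.inner_def]
  refine integral_congr_ae ?_
  filter_upwards [hg, hh] with x h1 h2
  rw [h1, h2, real_inner_smul_left, real_inner_smul_right, ← mul_assoc,
    Real.mul_self_sqrt (hα.le.trans (le_conductivity hαβ x))]

lemma norm_sq_eq_energy (hα : 0 < α) (hαβ : α ≤ β)
    {f : Lp (EuclideanSpace ℝ (Fin n)) 2 (volume.restrict Ω)}
    (hg : f =ᵐ[volume.restrict Ω] fun x => √(conductivity α β D x) • g x) :
    ‖f‖ ^ 2 = ∫ x in Ω, conductivity α β D x * ‖g x‖ ^ 2 := by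
  rw [← real_inner_self_eq_norm_sq, inner_toLp_eq_energy hα hαβ hg hg]
  simp_rw [real_inner_self_eq_norm_sq]

end Weight

/-- The pairs `(φ, √σ ∇φ)`, where `φ` is a test function and `σ` is the conductivity, as a subspace
of `L²(Ω) × L²(Ω; ℝⁿ)`. -/
def weightedGraph (Ω : Set (EuclideanSpace ℝ (Fin n))) (α β : ℝ)
    (D : Set (EuclideanSpace ℝ (Fin n))) :
    Submodule ℝ (Lp ℝ 2 (volume.restrict Ω) ×
      Lp (EuclideanSpace ℝ (Fin n)) 2 (volume.restrict Ω)) where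
  carrier := {p | ∃ φ, IsTestFunction Ω φ ∧ p.1 =ᵐ[volume.restrict Ω] φ ∧
    p.2 =ᵐ[volume.restrict Ω] fun x => √(conductivity α β D x) • ∇ φ x}
  add_mem' := by
    rintro p q ⟨φ, hφ, h1, h2⟩ ⟨ψ, hψ, h3, h4⟩
    refine ⟨_, hφ.add hψ, ?_, ?_⟩
    · filter_upwards [h1, h3, Lp.coeFn_add p.1 q.1] with x e1 e3 e5
      rw [Prod.fst_add, e5, Pi.add_apply, e1, e3]
    · filter_upwards [h2, h4, Lp.coeFn_add p.2 q.2] with x e2 e4 e5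
      rw [Prod.snd_add, e5, Pi.add_apply, e2, e4,
        gradient_add_apply hφ.differentiable hψ.differentiable, smul_add]
  zero_mem' := by
    refine ⟨_, IsTestFunction.zero, Lp.coeFn_zero _ _ _, ?_⟩
    filter_upwards [Lp.coeFn_zero (EuclideanSpace ℝ (Fin n)) 2 (volume.restrict Ω)] with x hx
    rw [Prod.snd_zero, hx]
    simp [gradient_fun_const]
  smul_mem' := by
    rintro c p ⟨φ, hφ, h1, h2⟩
    refine ⟨_, hφ.const_mul c, ?_, ?_⟩
    · filter_upwards [h1, Lp.coeFn_smul c p.1] with x e1 e3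
      rw [Prod.smul_fst, e3, Pi.smul_apply, e1, smul_eq_mul]
    · filter_upwards [h2, Lp.coeFn_smul c p.2] with x e2 e3
      rw [Prod.smul_snd, e3, Pi.smul_apply, e2, gradient_const_mul_apply hφ.differentiable,
        smul_comm]

/-- A test function as an element of the weighted graph. -/
lemma IsTestFunction.exists_mem_weightedGraph {φ : EuclideanSpace ℝ (Fin n) → ℝ} (hαβ : α ≤ β)
    (hD : NullMeasurableSet D (volume.restrict Ω)) (hφ : IsTestFunction Ω φ) :
    ∃ p ∈ weightedGraph Ω α β D, p.1 =ᵐ[volume.restrict Ω] φ ∧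
      p.2 =ᵐ[volume.restrict Ω] fun x => √(conductivity α β D x) • ∇ φ x :=
  have hg := memLp_sqrt_conductivity_smul hαβ hD hφ.memLp_gradient
  ⟨(hφ.memLp.toLp, hg.toLp), ⟨φ, hφ, hφ.memLp.coeFn_toLp, hg.coeFn_toLp⟩,
    hφ.memLp.coeFn_toLp, hg.coeFn_toLp⟩

/-- Elements of `H¹₀(Ω)` give elements of the closure of the weighted graph. -/
theorem MemH10.exists_mem_closure (hα : 0 < α) (hαβ : α ≤ β)
    (hD : NullMeasurableSet D (volume.restrict Ω)) {u : EuclideanSpace ℝ (Fin n) → ℝ}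
    {g : EuclideanSpace ℝ (Fin n) → EuclideanSpace ℝ (Fin n)} (hu : MemH10 Ω u g) :
    ∃ p ∈ (weightedGraph Ω α β D).topologicalClosure, p.1 =ᵐ[volume.restrict Ω] u ∧
      p.2 =ᵐ[volume.restrict Ω] fun x => √(conductivity α β D x) • g x := by
  have hg := memLp_sqrt_conductivity_smul hαβ hD hu.memLp_grad
  refine ⟨(hu.memLp.toLp, hg.toLp), ?_, hu.memLp.coeFn_toLp, hg.coeFn_toLp⟩
  rw [← SetLike.mem_coe, Submodule.topologicalClosure_coe, EMetric.mem_closure_iff]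
  intro ε hε
  have hβ : ENNReal.ofReal √β ≠ 0 := by
    simpa using hα.trans_le hαβ
  have hε' : 0 < ε / ENNReal.ofReal √β := ENNReal.div_pos hε.ne' ENNReal.ofReal_ne_top
  -- Multiplication by `√σ` enlarges the gradient error by at most `√β`.
  obtain ⟨φ, hφ, h1, h2⟩ := hu.approx (min ε (ε / ENNReal.ofReal √β)) (lt_min hε hε')
  have hgφ := memLp_sqrt_conductivity_smul hαβ hD hφ.memLp_gradient
  refine ⟨(hφ.memLp.toLp, hgφ.toLp), ⟨φ, hφ, hφ.memLp.coeFn_toLp, hgφ.coeFn_toLp⟩, ?_⟩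
  rw [Prod.edist_eq, max_lt_iff]
  simp only [Lp.edist_toLp_toLp]
  refine ⟨h1.trans_le (min_le_left _ _), ?_⟩
  refine (eLpNorm_le_mul_eLpNorm_of_ae_le_mul (g := fun x => g x - ∇ φ x) (c := √β)
    (Eventually.of_forall fun x => ?_) 2).trans_lt
    (ENNReal.mul_lt_of_lt_div' (h2.trans_le (min_le_right _ _)))
  simpa [smul_sub] using norm_sqrt_conductivity_smul_le (D := D) hαβ x (g x - ∇ φ x)

/-- Integration by parts for two test functions. -/
lemma IsTestFunction.hasWeakGradient {ψ : EuclideanSpace ℝ (Fin n) → ℝ}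
    (hψ : IsTestFunction Ω ψ) : HasWeakGradient Ω ψ (∇ ψ) := by
  intro φ hφ
  have hi : ∀ {φ ψ : EuclideanSpace ℝ (Fin n) → ℝ}, IsTestFunction Ω φ → IsTestFunction Ω ψ →
      Integrable (fun x => ψ x • ∇ φ x) := fun {φ ψ} hφ hψ =>
    (hψ.smooth.continuous.smul hφ.continuous_gradient).integrable_of_hasCompactSupport
      hψ.compact.smul_right
  rw [setIntegral_eq_integral_of_forall_compl_eq_zero
      fun x hx => by simp [hψ.eq_zero_of_notMem hx],
    setIntegral_eq_integral_of_forall_compl_eq_zero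
      fun x hx => by simp [hφ.eq_zero_of_notMem hx]]
  refine ext_inner_left ℝ fun v => ?_
  rw [inner_neg_right, ← integral_inner (hi hφ hψ), ← integral_inner (hi hψ hφ)]
  have key : ∀ {φ ψ : EuclideanSpace ℝ (Fin n) → ℝ} (x : EuclideanSpace ℝ (Fin n)),
      inner ℝ v (ψ x • ∇ φ x) = ψ x * fderiv ℝ φ x v := fun {φ ψ} x => by
    rw [real_inner_smul_right, real_inner_comm, inner_gradient_left]
  have i1 := (hi hφ hψ).const_inner (𝕜 := ℝ) v
  have i2 := (hi hψ hφ).const_inner (𝕜 := ℝ) v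
  simp_rw [key] at i1 i2 ⊢
  rw [integral_mul_fderiv_eq_neg_fderiv_mul_of_integrable _ i1
    ((hψ.smooth.continuous.mul hφ.smooth.continuous).integrable_of_hasCompactSupport
      hψ.compact.mul_right) (fun x _ => hψ.differentiable x) (fun x _ => hφ.differentiable x)]
  · simp_rw [mul_comm]
  · simpa only [mul_comm] using i2

/-- Elements of the closure of the weighted graph come from elements of `H¹₀(Ω)`. -/
theorem exists_memH10_of_mem_closure (hα : 0 < α) (hαβ : α ≤ β)
    (hD : NullMeasurableSet D (volume.restrict Ω)) {p : Lp ℝ 2 (volume.restrict Ω) ×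
      Lp (EuclideanSpace ℝ (Fin n)) 2 (volume.restrict Ω)}
    (hp : p ∈ (weightedGraph Ω α β D).topologicalClosure) :
    ∃ u g, MemH10 Ω u g ∧ p.1 =ᵐ[volume.restrict Ω] u ∧
      p.2 =ᵐ[volume.restrict Ω] fun x => √(conductivity α β D x) • g x := by
  rw [← SetLike.mem_coe, Submodule.topologicalClosure_coe] at hp
  set w : EuclideanSpace ℝ (Fin n) → ℝ := fun x => √(conductivity α β D x) with hw
  have hw0 : ∀ x, w x ≠ 0 := sqrt_conductivity_ne_zero hα hαβ
  have hg := memLp_inv_sqrt_conductivity_smul hα hαβ hD (Lp.memLp p.2)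
  have hwg : p.2 =ᵐ[volume.restrict Ω] fun x => w x • (w x)⁻¹ • p.2 x :=
    Eventually.of_forall fun x => (smul_inv_smul₀ (hw0 x) _).symm
  refine ⟨p.1, fun x => (w x)⁻¹ • p.2 x, ⟨Lp.memLp p.1, hg, ?_, ?_⟩, EventuallyEq.rfl, hwg⟩
  · intro φ hφ
    have hφg : ∀ {g : EuclideanSpace ℝ (Fin n) → EuclideanSpace ℝ (Fin n)},
        MemLp g 2 (volume.restrict Ω) → Integrable (fun x => φ x • g x) (volume.restrict Ω) :=
      fun hg => memLp_one_iff_integrable.1 (hg.smul hφ.memLp)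
    have hug : ∀ {u : EuclideanSpace ℝ (Fin n) → ℝ},
        MemLp u 2 (volume.restrict Ω) → Integrable (fun x => u x • ∇ φ x) (volume.restrict Ω) :=
      fun hu => memLp_one_iff_integrable.1 (hφ.memLp_gradient.smul hu)
    refine ext_inner_left ℝ fun v => ?_
    have hA : MemLp (fun x => inner ℝ v (∇ φ x)) 2 (volume.restrict Ω) :=
      hφ.memLp_gradient.const_inner v
    have hB : MemLp (fun x => φ x • v) 2 (volume.restrict Ω) :=
      hφ.memLp.of_le_mul (c := ‖v‖) (hφ.memLp.1.smul_const v)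
        (Eventually.of_forall fun x => by rw [norm_smul, mul_comm])
    -- The factor `1 / √σ` cancels the weight carried by the second component, leaving `φ ⟨v, g⟩`.
    have hB' := memLp_inv_sqrt_conductivity_smul hα hαβ hD hB
    have hpair : ∀ {q : Lp ℝ 2 (volume.restrict Ω) ×
          Lp (EuclideanSpace ℝ (Fin n)) 2 (volume.restrict Ω)}
        {u : EuclideanSpace ℝ (Fin n) → ℝ}
        {g : EuclideanSpace ℝ (Fin n) → EuclideanSpace ℝ (Fin n)},
        MemLp u 2 (volume.restrict Ω) → MemLp g 2 (volume.restrict Ω) →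
        q.1 =ᵐ[volume.restrict Ω] u → q.2 =ᵐ[volume.restrict Ω] (fun x => w x • g x) →
        inner ℝ q.1 hA.toLp + inner ℝ q.2 hB'.toLp
          = inner ℝ v (∫ x in Ω, u x • ∇ φ x) - inner ℝ v (- ∫ x in Ω, φ x • g x) := by
      intro q u g hu hg h1 h2
      rw [inner_neg_right, sub_neg_eq_add, ← integral_inner (hug hu), ← integral_inner (hφg hg),
        inner_toLp_eq_integral_mul h1 hA.coeFn_toLp, L2.inner_def]
      congr 1
      · simp_rw [real_inner_smul_right]
      · refine integral_congr_ae ?_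
        filter_upwards [h2, hB'.coeFn_toLp] with x e1 e2
        rw [e1, e2, real_inner_smul_left, real_inner_smul_right, ← mul_assoc,
          mul_inv_cancel₀ (hw0 x), one_mul, real_inner_smul_right, real_inner_smul_right,
          real_inner_comm]
    -- Tested against `v`, the weak gradient identity says that a continuous functional of the pair
    -- vanishes; it holds on the graph by integration by parts, hence on the closure.
    have hclosed : IsClosed {q : Lp ℝ 2 (volume.restrict Ω) ×
        Lp (EuclideanSpace ℝ (Fin n)) 2 (volume.restrict Ω) |
        inner ℝ q.1 hA.toLp + inner ℝ q.2 hB'.toLp = 0} :=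
      isClosed_eq (by fun_prop) continuous_const
    have hzero := closure_minimal (fun q hq => ?_) hclosed hp
    · rw [mem_ofPred_eq, hpair (Lp.memLp p.1) hg EventuallyEq.rfl hwg] at hzero
      exact sub_eq_zero.1 hzero
    · obtain ⟨ψ, hψ, h1, h2⟩ := hq
      rw [mem_ofPred_eq, hpair hψ.memLp hψ.memLp_gradient h1 h2, hψ.hasWeakGradient φ hφ, sub_self]
  · intro ε hε
    have hα' : ENNReal.ofReal √α ≠ 0 := by simpa using hα
    obtain ⟨q, ⟨φ, hφ, h1, h2⟩, hpq⟩ := EMetric.mem_closure_iff.1 hp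
      (min ε (ε * ENNReal.ofReal √α)) (lt_min hε (ENNReal.mul_pos hε.ne' hα'))
    rw [Prod.edist_eq, max_lt_iff, Lp.edist_def, Lp.edist_def] at hpq
    refine ⟨φ, hφ, ?_, ?_⟩
    · refine (eLpNorm_congr_ae ?_).trans_lt (hpq.1.trans_le (min_le_left _ _))
      filter_upwards [h1] with x e1
      rw [Pi.sub_apply, e1]
    · refine lt_of_le_of_lt ?_
        (ENNReal.div_lt_of_lt_mul (hpq.2.trans_le (min_le_right _ _)))
      rw [div_eq_mul_inv, mul_comm, ← ENNReal.ofReal_inv_of_pos (Real.sqrt_pos.2 hα)]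
      refine eLpNorm_le_mul_eLpNorm_of_ae_le_mul ?_ 2
      filter_upwards [h2] with x e2
      have h := norm_le_inv_sqrt_mul (D := D) hα hαβ x ((w x)⁻¹ • p.2 x - ∇ φ x)
      change _ ≤ (√α)⁻¹ * ‖w x • _‖ at h
      rw [smul_sub, smul_inv_smul₀ (hw0 x)] at h
      rwa [Pi.sub_apply, e2]

/-- A nonempty open set carries a test function that does not vanish almost everywhere. -/
lemma exists_isTestFunction_ne_zero (hΩ : IsOpen Ω) (hne : Ω.Nonempty) :
    ∃ φ, IsTestFunction Ω φ ∧ ¬ (φ =ᵐ[volume.restrict Ω] 0) := by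
  obtain ⟨x, hx⟩ := hne
  obtain ⟨φ, h1, h2, h3, -, h5⟩ := exists_contDiff_tsupport_subset (n := ⊤) (hΩ.mem_nhds hx)
  refine ⟨φ, ⟨h3, h2, h1⟩, fun h => ?_⟩
  have := Measure.eqOn_open_of_ae_eq h hΩ h3.continuous.continuousOn continuousOn_const hx
  rw [h5] at this
  exact one_ne_zero this

end Energy

/-! ### The variational principle and the bathtub principle. -/

section GroundState

open Filter Topology

variable {n : ℕ} {Ω D : Set (EuclideanSpace ℝ (Fin n))} {α β l : ℝ}
  {u : EuclideanSpace ℝ (Fin n) → ℝ} {g : EuclideanSpace ℝ (Fin n) → EuclideanSpace ℝ (Fin n)}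

/-- The energy identity, obtained by testing the weak equation with the eigenfunction. -/
lemma IsEigenfunction.energy_eq (hα : 0 < α) (hαβ : α ≤ β)
    (hD : NullMeasurableSet D (volume.restrict Ω)) (hu : IsEigenfunction Ω α β D l u g) :
    ∫ x in Ω, conductivity α β D x * ‖g x‖ ^ 2 = l * ∫ x in Ω, u x ^ 2 := by
  obtain ⟨p, hp, h1, h2⟩ := hu.memH10.exists_mem_closure hα hαβ hD
  rw [← norm_sq_eq_energy hα hαβ h2, ← norm_sq_eq_integral_sq h1, ← real_inner_self_eq_norm_sq,
    ← real_inner_self_eq_norm_sq]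
  rw [← SetLike.mem_coe, Submodule.topologicalClosure_coe] at hp
  -- The weak equation is given for test functions only; both sides are continuous in `q`, so it
  -- extends to the closure, which contains the eigenfunction's own pair `p`.
  refine closure_minimal (t := {q | inner ℝ p.2 q.2 = l * inner ℝ p.1 q.1}) ?_
    (isClosed_eq (by fun_prop) (by fun_prop)) hp
  rintro q ⟨φ, hφ, h3, h4⟩
  rw [mem_ofPred_eq, inner_toLp_eq_energy hα hαβ h2 h4, inner_toLp_eq_integral_mul h1 h3,
    hu.weak_eq φ hφ]

lemma integral_sq_pos (hu : MemLp u 2 (volume.restrict Ω)) (h0 : ¬ (u =ᵐ[volume.restrict Ω] 0)) :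
    0 < ∫ x in Ω, u x ^ 2 := by
  rw [← norm_sq_eq_integral_sq hu.coeFn_toLp]
  have : hu.toLp ≠ 0 := fun h => h0 (hu.coeFn_toLp.symm.trans (Lp.eq_zero_iff_ae_eq_zero.1 h))
  have := norm_pos_iff.2 this
  positivity

/-- The smallest positive eigenvalue exists and is the minimum of the Rayleigh quotient on
`H¹₀(Ω)`. -/
theorem exists_isLeast_posEigenvalues (hn : 0 < n) (hΩ : IsOpen Ω) (hne : Ω.Nonempty)
    (hfin : volume Ω ≠ ⊤) (hα : 0 < α) (hαβ : α ≤ β)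
    (hD : NullMeasurableSet D (volume.restrict Ω)) :
    ∃ m > 0, IsLeast (posEigenvalues Ω α β D) m ∧ ∀ u g, MemH10 Ω u g →
      m * ∫ x in Ω, u x ^ 2 ≤ ∫ x in Ω, conductivity α β D x * ‖g x‖ ^ 2 := by
  obtain ⟨C, hC, hP⟩ := IsTestFunction.poincare hn hfin
  have hgrad : ∀ {p : Lp ℝ 2 (volume.restrict Ω) ×
        Lp (EuclideanSpace ℝ (Fin n)) 2 (volume.restrict Ω)} {φ : EuclideanSpace ℝ (Fin n) → ℝ},
      IsTestFunction Ω φ →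
      p.2 =ᵐ[volume.restrict Ω] (fun x => √(conductivity α β D x) • ∇ φ x) →
      ∫ x in Ω, ‖∇ φ x‖ ^ 2 ≤ α⁻¹ * ‖p.2‖ ^ 2 := by
    intro p φ hφ h2
    rw [norm_sq_eq_energy hα hαβ h2, ← integral_const_mul]
    have hi := hφ.memLp_gradient.integrable_norm_pow (p := 2) (by norm_num)
    refine integral_mono hi ?_ fun x => ?_
    · refine (hi.bdd_mul (c := β) (aestronglyMeasurable_conductivity hD)
        (Eventually.of_forall fun x => ?_)).const_mul _
      rw [Real.norm_of_nonneg (hα.le.trans (le_conductivity hαβ x))]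
      exact conductivity_le hαβ x
    · simp only
      rw [← div_eq_inv_mul, le_div_iff₀ hα, mul_comm]
      gcongr
      exact le_conductivity hαβ x
  have hP' : ∀ p ∈ weightedGraph Ω α β D, ‖p.1‖ ^ 2 ≤ (C * α⁻¹) * ‖p.2‖ ^ 2 := by
    rintro p ⟨φ, hφ, h1, h2⟩
    rw [norm_sq_eq_integral_sq h1, mul_assoc]
    exact (hP φ hφ).trans (by gcongr; exact hgrad hφ h2)
  obtain ⟨m, hm, hmin, p, hp, hp0, hpeq⟩ := exists_rayleigh_minimizer (weightedGraph Ω α β D) hP'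
    (by
      intro p hp R hR
      choose φ hφ h1 h2 using hp
      have hb : ∀ k, ∫ x in Ω, ‖∇ (φ k) x‖ ^ 2 ≤ α⁻¹ * R := fun k =>
        (hgrad (hφ k) (h2 k)).trans (by gcongr; exact hR k)
      -- The energy bound suffices: Poincaré supplies the `L²` bound that `rellich` also asks for.
      obtain ⟨j, hj, hcau⟩ := IsTestFunction.rellich hfin hφ (M := C * (α⁻¹ * R))
        (fun k => (hP _ (hφ k)).trans (by gcongr; exact hb k)) hb
      refine ⟨j, hj, Metric.cauchySeq_iff.2 fun ε hε => ?_⟩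
      obtain ⟨N, hN⟩ := hcau (ε ^ 2) (by positivity)
      refine ⟨N, fun k hk l hl => ?_⟩
      rw [dist_eq_norm]
      refine lt_of_pow_lt_pow_left₀ 2 hε.le ?_
      refine lt_of_eq_of_lt (norm_sq_eq_integral_sq ?_) (hN k hk l hl)
      filter_upwards [h1 (j k), h1 (j l), Lp.coeFn_sub (p (j k)).1 (p (j l)).1] with x e1 e2 e3
      rw [e3, Pi.sub_apply, e1, e2])
    (by
      obtain ⟨φ, hφ, h0⟩ := exists_isTestFunction_ne_zero hΩ hne
      obtain ⟨p, hp, h1, -⟩ := hφ.exists_mem_weightedGraph (α := α) hαβ hD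
      refine ⟨p, hp, fun h => h0 (h1.symm.trans ?_)⟩
      rw [h]
      exact Lp.coeFn_zero _ _ _)
  have hray : ∀ u g, MemH10 Ω u g →
      m * ∫ x in Ω, u x ^ 2 ≤ ∫ x in Ω, conductivity α β D x * ‖g x‖ ^ 2 := by
    intro u g hu
    obtain ⟨q, hq, h1, h2⟩ := hu.exists_mem_closure hα hαβ hD
    rw [← norm_sq_eq_energy hα hαβ h2, ← norm_sq_eq_integral_sq h1]
    exact hmin q hq
  refine ⟨m, hm, ⟨⟨hm, ?_⟩, ?_⟩, hray⟩
  · obtain ⟨u, g, hu, h1, h2⟩ := exists_memH10_of_mem_closure hα hαβ hD hp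
    refine ⟨u, g, hu, fun h => hp0 ((Lp.eq_zero_iff_ae_eq_zero).2 (h1.trans h)), fun φ hφ => ?_⟩
    obtain ⟨q, hq, h3, h4⟩ := hφ.exists_mem_weightedGraph (α := α) hαβ hD
    rw [← inner_toLp_eq_energy hα hαβ h2 h4, ← inner_toLp_eq_integral_mul h1 h3, hpeq q hq]
  -- By the energy identity every eigenvalue is the Rayleigh quotient of its eigenfunction, hence at
  -- least `m`.
  · rintro l ⟨-, u, g, hu⟩
    have h := hray u g hu.memH10
    rw [hu.energy_eq hα hαβ hD] at h
    exact le_of_mul_le_mul_right h (integral_sq_pos hu.memH10.memLp hu.ne_zero)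

/-- The bathtub principle: among the sets of a given measure, a sublevel set of `f` minimizes the
integral of `f ^ 2`, and it is the only minimizer up to null sets. -/
theorem setIntegral_sq_sublevel_le {X : Type*} [MeasurableSpace X] {μ : Measure X} {f : X → ℝ}
    {A B : Set X} {t : ℝ} (hf : Integrable (fun x => f x ^ 2) μ) (hf0 : ∀ x, 0 ≤ f x)
    (hA : NullMeasurableSet A μ) (hB : NullMeasurableSet B μ) (hAB : μ A = μ B) (hfin : μ B ≠ ⊤)
    (hA1 : ∀ x ∈ A, f x ≤ t) (hA2 : ∀ᵐ x ∂μ, x ∉ A → t < f x) :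
    ∫ x in A, f x ^ 2 ∂μ ≤ ∫ x in B, f x ^ 2 ∂μ ∧
      (μ (symmDiff A B) ≠ 0 → ∫ x in A, f x ^ 2 ∂μ < ∫ x in B, f x ^ 2 ∂μ) := by
  -- The common part `A ∩ B` cancels; what remains are two sets of equal measure, with `f ≤ t` on `A
  -- \ B` and `f > t` almost everywhere on `B \ A`.
  have hdiff : μ (A \ B) = μ (B \ A) := by
    have h1 := measure_inter_add_sdiff₀ A hB
    have h2 := measure_inter_add_sdiff₀ B hA
    rw [← hAB, ← h1, inter_comm B A] at h2
    exact ((ENNReal.add_right_inj (measure_ne_top_of_subset inter_subset_right hfin)).1 h2).symm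
  have hfin' : μ (B \ A) ≠ ⊤ := measure_ne_top_of_subset sdiff_subset hfin
  have hdiffr : μ.real (A \ B) = μ.real (B \ A) := by simp only [measureReal_def, hdiff]
  have eA : ∫ x in A, f x ^ 2 ∂μ = (∫ x in A ∩ B, f x ^ 2 ∂μ) + ∫ x in A \ B, f x ^ 2 ∂μ :=
    (integral_inter_add_sdiff₀ hB hf.integrableOn).symm
  have eB : ∫ x in B, f x ^ 2 ∂μ = (∫ x in A ∩ B, f x ^ 2 ∂μ) + ∫ x in B \ A, f x ^ 2 ∂μ := by
    rw [inter_comm]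
    exact (integral_inter_add_sdiff₀ hA hf.integrableOn).symm
  have hup : ∫ x in A \ B, f x ^ 2 ∂μ ≤ μ.real (B \ A) * t ^ 2 := by
    have h := setIntegral_mono_on₀ (μ := μ) (s := A \ B) hf.integrableOn
      (integrableOn_const (C := t ^ 2) (hdiff ▸ hfin')) (hA.diff hB) fun x hx =>
        pow_le_pow_left₀ (hf0 x) (hA1 x hx.1) 2
    rwa [setIntegral_const, smul_eq_mul, hdiffr] at h
  by_cases h0 : μ (B \ A) = 0
  · have hz : μ (symmDiff A B) = 0 := by
      rw [symmDiff_def]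
      exact measure_union_null (hdiff.trans h0) h0
    refine ⟨?_, fun h => absurd hz h⟩
    rw [eA, eB, Measure.restrict_zero_set h0, Measure.restrict_zero_set (hdiff.trans h0)]
  · have hlt : μ.real (B \ A) * t ^ 2 < ∫ x in B \ A, f x ^ 2 ∂μ := by
      -- Squaring `t < f x` needs `t ≥ 0`, which follows from any point of the non-null set `A \ B`.
      have ht : 0 ≤ t := by
        obtain ⟨x, hx⟩ := nonempty_of_measure_ne_zero (hdiff ▸ h0 : μ (A \ B) ≠ 0)
        exact (hf0 x).trans (hA1 x hx.1)
      have hint : IntegrableOn (fun x => f x ^ 2 - t ^ 2) (B \ A) μ :=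
        hf.integrableOn.sub (integrableOn_const hfin')
      have hpos : ∀ᵐ x ∂μ.restrict (B \ A), 0 < f x ^ 2 - t ^ 2 := by
        filter_upwards [ae_restrict_of_ae hA2, ae_restrict_mem₀ (hB.diff hA)] with x h1 h2
        have := pow_lt_pow_left₀ (h1 h2.2) ht (two_ne_zero)
        linarith
      have : 0 < ∫ x in B \ A, (f x ^ 2 - t ^ 2) ∂μ := by
        rw [integral_pos_iff_support_of_nonneg_ae (hpos.mono fun x hx => hx.le) hint,
          pos_iff_ne_zero]
        intro hs
        rw [measure_eq_zero_iff_ae_notMem] at hs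
        have hf : ∀ᵐ x ∂μ.restrict (B \ A), False := by
          filter_upwards [hs, hpos] with x h1 h2 using h1 h2.ne'
        rw [eventually_false_iff_eq_bot, ae_eq_bot, Measure.restrict_eq_zero] at hf
        exact h0 hf
      rw [integral_sub hf.integrableOn (integrableOn_const hfin'), setIntegral_const,
        smul_eq_mul] at this
      linarith
    have := hup.trans_lt hlt
    exact ⟨by linarith, fun _ => by linarith⟩

/-- For fixed `g` this isolates the dependence on `D` in one term with coefficient `β - α`, to which
the bathtub principle applies. -/
lemma integral_conductivity_mul (hD : NullMeasurableSet D (volume.restrict Ω))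
    (hg : MemLp g 2 (volume.restrict Ω)) :
    ∫ x in Ω, conductivity α β D x * ‖g x‖ ^ 2
      = α * (∫ x in Ω, ‖g x‖ ^ 2)
        + (β - α) * ∫ x in D, ‖g x‖ ^ 2 ∂(volume.restrict Ω) := by
  have hi : Integrable (fun x => ‖g x‖ ^ 2) (volume.restrict Ω) :=
    hg.integrable_norm_pow (by norm_num)
  rw [← integral_indicator₀ hD, ← integral_const_mul, ← integral_const_mul,
    ← integral_add (hi.const_mul _) ((hi.indicator₀ hD).const_mul _)]
  refine integral_congr_ae (Eventually.of_forall fun x => ?_)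
  by_cases hx : x ∈ D <;> simp [conductivity, hx]
  ring

end GroundState

end TwoPhase

/-! ### Comparison of the two ground states. -/

theorem theorem3p2 (n : ℕ) (hn : 2 ≤ n) (α β A t : ℝ) (hα : 0 < α) (hαβ : α < β)
    (Ω : Set (EuclideanSpace ℝ (Fin n))) (hΩ : Ω = Metric.ball 0 1)
    (hA : 0 < A) (hAΩ : ENNReal.ofReal A < volume Ω)
    (D₀ D₁ : Set (EuclideanSpace ℝ (Fin n)))
    (hD₀Ω : D₀ ⊆ Ω) (hD₀meas : NullMeasurableSet D₀ volume)
    (hD₀ : volume D₀ = ENNReal.ofReal A)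
    (u₀ : EuclideanSpace ℝ (Fin n) → ℝ)
    (gradu₀ : EuclideanSpace ℝ (Fin n) → EuclideanSpace ℝ (Fin n))
    (hu₀ : TwoPhase.IsEigenfunction Ω α β D₀ (TwoPhase.groundStateEnergy Ω α β D₀) u₀ gradu₀)
    (ht : t = sInf {s : ℝ | ENNReal.ofReal A ≤ volume {x ∈ Ω | ‖gradu₀ x‖ ≤ s}})
    (hD₁ : D₁ = {x ∈ Ω | ‖gradu₀ x‖ ≤ t})
    (hD₁vol : volume D₁ = ENNReal.ofReal A) :
    IsLeast (TwoPhase.posEigenvalues Ω α β D₁) (TwoPhase.groundStateEnergy Ω α β D₁) ∧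
    TwoPhase.groundStateEnergy Ω α β D₁ ≤ TwoPhase.groundStateEnergy Ω α β D₀ ∧
    (volume (symmDiff D₁ D₀) ≠ 0 →
      TwoPhase.groundStateEnergy Ω α β D₁ < TwoPhase.groundStateEnergy Ω α β D₀) := by
  have hΩo : IsOpen Ω := hΩ ▸ Metric.isOpen_ball
  have hne : Ω.Nonempty := ⟨0, by simp [hΩ]⟩
  have hfin : volume Ω ≠ ⊤ := hΩ ▸ measure_ball_lt_top.ne
  have hm₀ : NullMeasurableSet D₀ (volume.restrict Ω) :=
    hD₀meas.mono_ac Measure.restrict_le_self.absolutelyContinuous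
  have hg := hu₀.memH10.memLp_grad
  have hD₁Ω : D₁ ⊆ Ω := hD₁ ▸ fun x hx => hx.1
  -- The weak gradient is only almost everywhere strongly measurable on `Ω`, so its sublevel set is
  -- in general only null measurable.
  have hm₁ : NullMeasurableSet D₁ (volume.restrict Ω) := by
    rw [hD₁]
    exact hΩo.measurableSet.nullMeasurableSet.inter
      (nullMeasurableSet_le hg.1.norm.aemeasurable aemeasurable_const)
  obtain ⟨m, -, hleast, hray⟩ := TwoPhase.exists_isLeast_posEigenvalues (by omega) hΩo hne hfin hα
    hαβ.le hm₁
  have hm : TwoPhase.groundStateEnergy Ω α β D₁ = m := hleast.csInf_eq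
  have hpos := TwoPhase.integral_sq_pos hu₀.memH10.memLp hu₀.ne_zero
  have henergy := hu₀.energy_eq hα hαβ.le hm₀
  -- Here `u₀` serves as trial function for `D₁`.
  have hrayleigh := hray u₀ gradu₀ hu₀.memH10
  rw [TwoPhase.integral_conductivity_mul hm₀ hg] at henergy
  rw [TwoPhase.integral_conductivity_mul hm₁ hg] at hrayleigh
  have hvol : ∀ {D : Set (EuclideanSpace ℝ (Fin n))}, D ⊆ Ω →
      volume.restrict Ω D = volume D := fun hD => Measure.restrict_eq_self _ hD
  have hbath := TwoPhase.setIntegral_sq_sublevel_le (μ := volume.restrict Ω)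
    (f := fun x => ‖gradu₀ x‖) (t := t) (hg.integrable_norm_pow (by norm_num))
    (fun x => norm_nonneg _) hm₁ hm₀ (by rw [hvol hD₁Ω, hvol hD₀Ω, hD₁vol, hD₀])
    (by rw [hvol hD₀Ω, hD₀]; exact ENNReal.ofReal_ne_top)
    (by rw [hD₁]; exact fun x hx => hx.2)
    (by
      filter_upwards [ae_restrict_mem hΩo.measurableSet] with x hx hxD
      rw [hD₁] at hxD
      exact not_le.1 fun h => hxD ⟨hx, h⟩)
  rw [hvol ((symmDiff_subset_union (s := D₁) (t := D₀)).trans (union_subset hD₁Ω hD₀Ω))] at hbath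
  have hβα : 0 < β - α := sub_pos.2 hαβ
  rw [hm]
  refine ⟨hleast, le_of_mul_le_mul_right (hrayleigh.trans ?_) hpos, fun h =>
    lt_of_mul_lt_mul_right (hrayleigh.trans_lt ?_) hpos.le⟩
  · rw [← henergy]
    linarith [mul_le_mul_of_nonneg_left hbath.1 hβα.le]
  · rw [← henergy]
    linarith [mul_lt_mul_of_pos_left (hbath.2 h) hβα]
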